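/- Let $X$ be a nonzero complex Banach sequence space, i.e. a complex Banach space which is a linear subspace of the space $\mathbb{C}^{\mathbb{N}}$ of all complex sequences and has the property that if $x\in X$, $a\in\mathbb{C}^{\mathbb N}$ and $|a(n)|\le|x(n)|$ for all $n$, then $a\in X$ and $\|a\|\le\|x\|$. Let $B_X$, $S_X$ be its closed unit ball and unit sphere and $B_{X^*}$ the closed unit ball of its dual. Suppose that - $X$ is order continuous: if $u_1\ge u_2\ge\dots\ge 0$ in $X$ and $u_k\to 0$ coordinatewise, then $\|u_k\|\to 0$; - $X$ is locally uniformly $c$-convex: for every $x\in S_X$ and $\varepsilon>0$ there is $\delta>0$ such that $\max_{|\zeta|=1}\|x+\zeta y\|\ge 1+\delta$ for all $y\in X$ with $\|y\|\ge\varepsilon$; - $X$ is smooth: for every $x\in S_X$ there is a unique $x^*\in B_{X^*}$ with $\operatorname{Re}x^*(x)=1$. Let $\mathcal{A}_u(B_X:X)$ be the Banach space of all bounded uniformly continuous functions $f:B_X\to X$ that are holomorphic on the interior of $B_X$, with the norm $\|f\|=\sup_{x\in B_X}\|f(x)\|$. Let $\Pi(X)=\{(x,x^*)\in B_X\times B_{X^*}: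 x^*(x)=1\}$, with the topology induced by the norm topology on $B_X$ and the weak-$*$ topology on $B_{X^*}$, and let $v(f)=\sup\{|x^*(f(x))|:(x,x^*)\in\Pi(X)\}$. A function $f\in\mathcal{A}_u(B_X:X)$ is a *(norm) strong peak function* if $f\neq0$ and there is $t\in B_X$ such that every sequence $(t_k)$ in $B_X$ with $\|f(t_k)\|\to\|f\|$ converges to $t$; it is a *numerical strong peak function* if there is $(x,x^*)\in\Pi(X)$ such that every sequence $((x_k,x_k^*))$ in $\Pi(X)$ with $|x_k^*(f(x_k))|\to v(f)$ converges to $(x,x^*)$ in $\Pi(X)$. Then the set of all $f\in\mathcal{A}_u(B_X:X)$ that are both norm strong peak functions and numerical strong peak functions is a dense $G_\delta$ subset of $\mathcal{A}_u(B_X:X)$. -/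

import Mathlib

open Filter Topology Metric
open scoped BoundedContinuousFunction

namespace PeakFunctions

/-- The complex normed space `X`, regarded through the coordinate map `coord` as a space of complex
sequences, is a sequence space with a lattice norm: `coord` is a linear embedding of `X` into the
space of all complex sequences and, if `|a| ≤ |x|` coordinatewise with `x ∈ X`, then the sequence `a`
belongs to `X` and `‖a‖ ≤ ‖x‖`.  For complete `X` this is a (complex) Banach sequence space. -/
structure IsSequenceSpace {X : Type*} [NormedAddCommGroup X] [NormedSpace ℂ X]
    (coord : X →ₗ[ℂ] (ℕ → ℂ)) : Prop where
  injective : Function.Injective coord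
  solid : ∀ (x : X) (a : ℕ → ℂ), (∀ n, ‖a n‖ ≤ ‖coord x n‖) → ∃ y : X, coord y = a ∧ ‖y‖ ≤ ‖x‖

/-- Order continuity of the norm of a sequence space: `‖u k‖ → 0` whenever `u` is a sequence of
real vectors with `u k ↓ 0`.  (In a solid space of sequences the order infimum of a decreasing
sequence of nonnegative vectors is its coordinatewise limit.) -/
def IsOrderContinuous {X : Type*} [NormedAddCommGroup X] [NormedSpace ℂ X]
    (coord : X →ₗ[ℂ] (ℕ → ℂ)) : Prop :=
  ∀ (u : ℕ → X) (r : ℕ → ℕ → ℝ), (∀ k n, coord (u k) n = (r k n : ℂ)) →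
    (∀ n, Antitone fun k => r k n) → (∀ n, Tendsto (fun k => r k n) atTop (𝓝 0)) →
    Tendsto (fun k => ‖u k‖) atTop (𝓝 0)

/-- Local uniform `c`-convexity: for `‖x‖ = 1` and `ε > 0` there is `δ > 0` with
`max_{|ζ| = 1} ‖x + ζ y‖ ≥ 1 + δ` for all `y` of norm at least `ε`. -/
def IsLocallyUniformlyCConvex (X : Type*) [NormedAddCommGroup X] [NormedSpace ℂ X] : Prop :=
  ∀ x : X, ‖x‖ = 1 → ∀ ε : ℝ, 0 < ε → ∃ δ : ℝ, 0 < δ ∧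
    ∀ y : X, ε ≤ ‖y‖ → ∃ ζ : ℂ, ‖ζ‖ = 1 ∧ 1 + δ ≤ ‖x + ζ • y‖

/-- Smoothness: every point of the unit sphere has exactly one supporting functional in the unit
ball of the dual space. -/
def IsSmooth (X : Type*) [NormedAddCommGroup X] [NormedSpace ℂ X] : Prop :=
  ∀ x : X, ‖x‖ = 1 → ∃! φ : StrongDual ℂ X, ‖φ‖ ≤ 1 ∧ (φ x).re = 1

section

variable (X : Type*) [NormedAddCommGroup X] [NormedSpace ℂ X]

/-- The space `A_u(B_X : X)` of the bounded, uniformly continuous functions from the closed unit ball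
`B_X` to `X` which are holomorphic on the open unit ball, with the supremum norm. -/
def Au : Submodule ℂ (closedBall (0 : X) 1 →ᵇ X) where
  carrier := {f | UniformContinuous f ∧
    DifferentiableOn ℂ (Function.extend Subtype.val f 0) (ball (0 : X) 1)}
  zero_mem' := by
    refine ⟨uniformContinuous_const, ?_⟩
    refine (differentiableOn_const (0 : X)).congr fun x hx => ?_
    exact Subtype.val_injective.extend_apply (0 : closedBall (0 : X) 1 →ᵇ X) 0
      ⟨x, ball_subset_closedBall hx⟩
  add_mem' := by
    rintro f g ⟨hf, hf'⟩ ⟨hg, hg'⟩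
    refine ⟨hf.add hg, (hf'.add hg').congr fun x hx => ?_⟩
    have h := fun k : closedBall (0 : X) 1 → X =>
      Subtype.val_injective.extend_apply k 0 ⟨x, ball_subset_closedBall hx⟩
    simp only at h
    simp only [Pi.add_apply, h]
    rfl
  smul_mem' := by
    rintro c f ⟨hf, hf'⟩
    refine ⟨hf.const_smul c, (hf'.const_smul c).congr fun x hx => ?_⟩
    have h := fun k : closedBall (0 : X) 1 → X =>
      Subtype.val_injective.extend_apply k 0 ⟨x, ball_subset_closedBall hx⟩
    simp only at h
    simp only [Pi.smul_apply, h]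
    rfl

/-- `Π(X)`, the set of the pairs `(x, x*)` in `B_X × B_{X*}` with `x*(x) = 1`; `B_X` carries the
norm topology and the dual space the weak-`*` topology. -/
def dualityPairs : Set (closedBall (0 : X) 1 × WeakDual ℂ X) :=
  {p | ‖WeakDual.toStrongDual p.2‖ ≤ 1 ∧ p.2 (p.1 : X) = 1}

variable {X}

/-- The numerical radius `v(f)`. -/
noncomputable def numericalRadius (f : closedBall (0 : X) 1 →ᵇ X) : ℝ :=
  ⨆ p : dualityPairs X, ‖p.1.2 (f p.1.1)‖

/-- `f` is a (norm) strong peak function. -/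
def IsStrongPeak (f : closedBall (0 : X) 1 →ᵇ X) : Prop :=
  f ≠ 0 ∧ ∃ t : closedBall (0 : X) 1, ∀ s : ℕ → closedBall (0 : X) 1,
    Tendsto (fun n => ‖f (s n)‖) atTop (𝓝 ‖f‖) → Tendsto s atTop (𝓝 t)

/-- `f` is a numerical strong peak function. -/
def IsNumericalStrongPeak (f : closedBall (0 : X) 1 →ᵇ X) : Prop :=
  ∃ q : dualityPairs X, ∀ p : ℕ → dualityPairs X,
    Tendsto (fun n => ‖(p n).1.2 (f (p n).1.1)‖) atTop (𝓝 (numericalRadius f)) →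
      Tendsto p atTop (𝓝 q)

end

end PeakFunctions

/-!
A maximizing sequence `s` of `f` is one along which `q s f` tends to `sup q s f`, where `q` is either
the family `f ↦ ‖f x‖` indexed by the ball or the family `f ↦ |x* (f x)|` indexed by the duality
pairs. All maximizing sequences converge to one point exactly when, for every `ε > 0`, the indices
with `q s f` close to the supremum have positions within `ε` of each other
(`forall_mem_concentrated_iff`). For fixed `ε` this is an open condition on `f`, so by the Baire
category theorem only its density is at stake; `A_u` is complete because uniform limits of
holomorphic functions on a Banach space are holomorphic. In the numerical case the positions are only
the points `x`: smoothness makes the duality map norm-to-weak-`*` continuous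
(`tendsto_dualityPairs`), so the functionals converge too.

Density follows from a supply of peak functions (`dense_concentrated`): add to `f` a small multiple
of a bump located at a point where `q s f` is nearly maximal. The bumps come from
`isEntirePeakPoint_of_finite_support`: every finitely supported unit vector `x₀` is a strong peak
point. Take a functional `φ` supporting the ball at `x₀` and put `w i z = φ (z i • e i)`. Since the
norm depends only on moduli, `∑ |w i z| ≤ ‖z‖`, hence the `w i x₀` are nonnegative with sum `1`, and
`G z = exp (4 (∑ w i z - 1) - ∑ (w i z - w i x₀)²)` satisfies
`|G z| ≤ exp (-∑ |w i z - w i x₀|²)` on the ball. Local uniform `c`-convexity enters twice: it gives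
`w i x₀ ≠ 0` on the support of `x₀`, so that `|G z|` close to `1` forces the coordinates of `z` in
this support to be close to those of `x₀`, and it shows that the rest of `z` is then small in norm.
By order continuity finitely supported vectors are dense in the unit sphere, and by the maximum
modulus principle and smoothness, respectively, they suffice to compute the suprema.
-/

namespace PeakFunctions

/-! ### Concentration of a family of seminorms and Baire category -/

section Concentration

variable {F S M : Type*} [NormedAddCommGroup F] [NormedSpace ℂ F] [PseudoMetricSpace M]

/-- For a family `q` of seminorms indexed by points `s` with position `pos s`: the elements `f` for
which the indices with `q s f` close to the supremum have positions at mutual distance at most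
`ε`. -/
def concentrated (q : S → Seminorm ℂ F) (pos : S → M) (ε : ℝ) : Set F :=
  {f | ∃ c < ⨆ s, q s f, ∀ s t, c < q s f → c < q t f → dist (pos s) (pos t) ≤ ε}

variable {q : S → Seminorm ℂ F} {pos : S → M}

theorem bddAbove_range_seminorm (hq : ∀ s f, q s f ≤ ‖f‖) (f : F) :
    BddAbove (Set.range fun s => q s f) :=
  ⟨‖f‖, by rintro _ ⟨s, rfl⟩; exact hq s f⟩

theorem seminorm_le_add_norm_sub (hq : ∀ s f, q s f ≤ ‖f‖) (s : S) (f g : F) :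
    q s f ≤ q s g + ‖f - g‖ := by
  have h := map_add_le_add (q s) g (f - g)
  rw [add_sub_cancel] at h
  linarith [hq s (f - g)]

theorem isOpen_concentrated [Nonempty S] (hq : ∀ s f, q s f ≤ ‖f‖) (ε : ℝ) :
    IsOpen (concentrated q pos ε) := by
  rw [Metric.isOpen_iff]
  rintro f ⟨c, hc, hdist⟩
  refine ⟨((⨆ s, q s f) - c) / 2, by linarith, fun g hg => ?_⟩
  rw [mem_ball, dist_eq_norm] at hg
  have hsup : (⨆ s, q s f) ≤ (⨆ s, q s g) + ‖g - f‖ := ciSup_le fun s => by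
    have h := seminorm_le_add_norm_sub hq s f g
    rw [norm_sub_rev] at h
    linarith [le_ciSup (bddAbove_range_seminorm hq g) s]
  refine ⟨c + ‖g - f‖, by linarith, fun s t hs ht => hdist s t ?_ ?_⟩
  · linarith [seminorm_le_add_norm_sub hq s g f]
  · linarith [seminorm_le_add_norm_sub hq t g f]

/-- If nearly maximizing indices can be raised by a perturbation that is small at distant positions,
then concentration is generic. -/
theorem dense_concentrated [Nonempty S] (hq : ∀ s f, q s f ≤ ‖f‖)
    (hpeak : ∀ (f : F) (δ : ℝ), 0 < δ → ∃ s, (⨆ s, q s f) - δ < q s f ∧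
      ∀ r : ℝ, 0 < r → ∀ η : ℝ, 0 < η → ∃ k : F, ‖k‖ ≤ 1 ∧
        (∀ ε : ℝ, 0 ≤ ε → q s f + ε ≤ q s (f + (ε : ℂ) • k)) ∧
        ∀ t, r ≤ dist (pos t) (pos s) → q t k ≤ η)
    {ε : ℝ} (hε : 0 < ε) : Dense (concentrated q pos ε) := by
  rw [Metric.dense_iff]
  intro f ρ hρ
  obtain ⟨s, hs, hs'⟩ := hpeak f (ρ / 2 / 4) (by positivity)
  obtain ⟨k, hk, hraise, hfar⟩ := hs' (ε / 2) (by positivity) (1 / 4) (by norm_num)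
  have hρk : ‖((ρ / 2 : ℝ) : ℂ)‖ = ρ / 2 := by
    rw [Complex.norm_real, Real.norm_of_nonneg (by positivity)]
  refine ⟨f + ((ρ / 2 : ℝ) : ℂ) • k, ?_, (⨆ s, q s f) + ρ / 2 / 4, ?_, ?_⟩
  · rw [mem_ball, dist_eq_norm, add_sub_cancel_left, norm_smul, hρk]
    nlinarith
  · have h1 := hraise (ρ / 2) (by positivity)
    have h2 := le_ciSup (bddAbove_range_seminorm hq (f + ((ρ / 2 : ℝ) : ℂ) • k)) s
    linarith
  · have key : ∀ t, (⨆ s, q s f) + ρ / 2 / 4 < q t (f + ((ρ / 2 : ℝ) : ℂ) • k) →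
        dist (pos t) (pos s) < ε / 2 := by
      intro t ht
      by_contra! hcon
      have h1 := map_add_le_add (q t) f (((ρ / 2 : ℝ) : ℂ) • k)
      rw [map_smul_eq_mul, hρk] at h1
      have h2 := le_ciSup (bddAbove_range_seminorm hq f) t
      nlinarith [hfar t hcon]
    intro t u ht hu
    linarith [key t ht, key u hu, dist_triangle_right (pos t) (pos u) (pos s)]

theorem exists_tendsto_iSup [Nonempty S] (g : S → ℝ) (hg : BddAbove (Set.range g)) :
    ∃ s : ℕ → S, Tendsto (fun n => g (s n)) atTop (𝓝 (⨆ t, g t)) := by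
  have h : ∀ n : ℕ, ∃ s, (⨆ t, g t) - 1 / ((n : ℝ) + 1) < g s := fun n =>
    exists_lt_of_lt_ciSup (sub_lt_self _ Nat.one_div_pos_of_nat)
  choose s hs using h
  refine ⟨s, tendsto_of_tendsto_of_tendsto_of_le_of_le ?_ tendsto_const_nhds
    (fun n => (hs n).le) fun n => le_ciSup hg (s n)⟩
  simpa using tendsto_const_nhds.sub (tendsto_one_div_add_atTop_nhds_zero_nat (𝕜 := ℝ))

/-- Concentration at every scale means that all maximizing sequences converge to a common point. -/
theorem forall_mem_concentrated_iff [Nonempty S] [CompleteSpace M] (hq : ∀ s f, q s f ≤ ‖f‖)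
    (f : F) :
    (∀ n : ℕ, f ∈ concentrated q pos (1 / ((n : ℝ) + 1))) ↔
      ∃ x : M, ∀ s : ℕ → S, Tendsto (fun n => q (s n) f) atTop (𝓝 (⨆ t, q t f)) →
        Tendsto (fun n => pos (s n)) atTop (𝓝 x) := by
  constructor
  · intro h
    have key : ∀ s t : ℕ → S, Tendsto (fun n => q (s n) f) atTop (𝓝 (⨆ t, q t f)) →
        Tendsto (fun n => q (t n) f) atTop (𝓝 (⨆ t, q t f)) → ∀ ε > 0, ∃ N, ∀ m ≥ N, ∀ n ≥ N,
          dist (pos (s m)) (pos (t n)) < ε := by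
      intro s t hs ht ε hε
      obtain ⟨n, hn⟩ := exists_nat_one_div_lt hε
      obtain ⟨c, hc, hd⟩ := h n
      obtain ⟨N₁, h₁⟩ := eventually_atTop.1 (hs.eventually_const_lt hc)
      obtain ⟨N₂, h₂⟩ := eventually_atTop.1 (ht.eventually_const_lt hc)
      exact ⟨max N₁ N₂, fun i hi j hj => (hd _ _ (h₁ i (le_of_max_le_left hi))
        (h₂ j (le_of_max_le_right hj))).trans_lt hn⟩
    obtain ⟨s₀, hs₀⟩ := exists_tendsto_iSup (fun s => q s f) (bddAbove_range_seminorm hq f)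
    obtain ⟨x, hx⟩ := cauchySeq_tendsto_of_complete
      (Metric.cauchySeq_iff.2 (key s₀ s₀ hs₀ hs₀))
    refine ⟨x, fun s hs => ?_⟩
    refine hx.congr_dist ?_
    rw [Metric.tendsto_atTop]
    intro ε hε
    obtain ⟨N, hN⟩ := key s₀ s hs₀ hs ε hε
    exact ⟨N, fun n hn => by simpa using hN n hn n hn⟩
  · rintro ⟨x, hx⟩ n
    by_contra hcon
    have hε : (0 : ℝ) < 1 / ((n : ℝ) + 1) := Nat.one_div_pos_of_nat
    set ε : ℝ := 1 / ((n : ℝ) + 1)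
    have h : ∀ k : ℕ, ∃ s t, (⨆ t, q t f) - 1 / ((k : ℝ) + 1) < q s f ∧
        (⨆ t, q t f) - 1 / ((k : ℝ) + 1) < q t f ∧ ε < dist (pos s) (pos t) := by
      intro k
      by_contra! hk
      exact hcon ⟨_, sub_lt_self _ Nat.one_div_pos_of_nat, hk⟩
    choose s t hs ht hst using h
    have hlim : ∀ u : ℕ → S, (∀ k : ℕ, (⨆ t, q t f) - 1 / ((k : ℝ) + 1) < q (u k) f) →
        Tendsto (fun n => pos (u n)) atTop (𝓝 x) := fun u hu => hx u <| by
      refine tendsto_of_tendsto_of_tendsto_of_le_of_le ?_ tendsto_const_nhds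
        (fun n => (hu n).le) fun n => le_ciSup (bddAbove_range_seminorm hq f) (u n)
      simpa using tendsto_const_nhds.sub (tendsto_one_div_add_atTop_nhds_zero_nat (𝕜 := ℝ))
    have hd := (hlim s hs).dist (hlim t ht)
    rw [dist_self] at hd
    exact absurd (ge_of_tendsto' hd fun k => (hst k).le) (not_le.2 hε)

end Concentration

/-! ### Completeness of the space of holomorphic functions -/

/-- A uniform limit of holomorphic functions on an open subset of a complex normed space is
holomorphic: by the Schwarz lemma, the derivatives are locally uniformly Cauchy. -/
theorem differentiableOn_of_tendstoUniformlyOn {E F : Type*} [NormedAddCommGroup E]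
    [NormedSpace ℂ E] [NormedAddCommGroup F] [NormedSpace ℂ F] [CompleteSpace F] {U : Set E}
    (hU : IsOpen U) {f : ℕ → E → F} {g : E → F} (hf : ∀ n, DifferentiableOn ℂ (f n) U)
    (hfg : TendstoUniformlyOn f g atTop U) : DifferentiableOn ℂ g U := by
  intro x hx
  obtain ⟨R, hR, hRU⟩ := Metric.isOpen_iff.1 hU x hx
  have hsub : ∀ y ∈ ball x (R / 2), ball y (R / 2) ⊆ U := fun y hy =>
    (ball_subset_ball' (by linarith [mem_ball.1 hy])).trans hRU
  have hmem : ∀ y ∈ ball x (R / 2), y ∈ U := fun y hy =>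
    hsub y hy (mem_ball_self (by positivity))
  have hcauchy : UniformCauchySeqOn (fun n => fderiv ℂ (f n)) atTop (ball x (R / 2)) := by
    rw [Metric.uniformCauchySeqOn_iff]
    intro ε hε
    obtain ⟨N, hN⟩ := Metric.uniformCauchySeqOn_iff.1 hfg.uniformCauchySeqOn (ε * (R / 2) / 4)
      (by positivity)
    refine ⟨N, fun m hm n hn y hy => ?_⟩
    have hd : ∀ k, DifferentiableAt ℂ (f k) y := fun k =>
      (hf k).differentiableAt (hU.mem_nhds (hmem y hy))
    rw [dist_eq_norm, ← fderiv_sub (hd m) (hd n)]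
    refine (Complex.norm_fderiv_le_div_of_mapsTo_ball (R₁ := R / 2) (R₂ := ε * (R / 2) / 2)
      (((hf m).sub (hf n)).mono (hsub y hy)) ?_ (by positivity)).trans_lt ?_
    · intro z hz
      have h1 := hN m hm n hn z (hsub y hy hz)
      have h2 := hN m hm n hn y (hmem y hy)
      rw [dist_eq_norm] at h1 h2
      rw [mem_closedBall, dist_eq_norm]
      refine (norm_sub_le _ _).trans ?_
      simp only [Pi.sub_apply]
      linarith
    · rw [div_lt_iff₀ (by positivity)]
      nlinarith
  have hlim : ∀ y ∈ ball x (R / 2), ∃ L, Tendsto (fun n => fderiv ℂ (f n) y) atTop (𝓝 L) :=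
    fun y hy => cauchySeq_tendsto_of_complete (hcauchy.cauchySeq hy)
  choose! g' hg' using hlim
  exact (hasFDerivAt_of_tendstoUniformlyOn isOpen_ball
    (hcauchy.tendstoUniformlyOn_of_tendsto hg')
    (fun n y hy => ((hf n).differentiableAt (hU.mem_nhds (hmem y hy))).hasFDerivAt)
    (fun y hy => hfg.tendsto_at (hmem y hy))
    (mem_ball_self (by positivity))).differentiableAt.differentiableWithinAt

section

variable {X : Type*} [NormedAddCommGroup X] [NormedSpace ℂ X]

omit [NormedSpace ℂ X] in
theorem extend_closedBall_apply (f : closedBall (0 : X) 1 → X) {x : X}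
    (hx : x ∈ ball (0 : X) 1) :
    Function.extend Subtype.val f 0 x = f ⟨x, ball_subset_closedBall hx⟩ :=
  Subtype.val_injective.extend_apply f 0 ⟨x, ball_subset_closedBall hx⟩

theorem isClosed_Au [CompleteSpace X] : IsClosed (Au X : Set (closedBall (0 : X) 1 →ᵇ X)) := by
  refine IsSeqClosed.isClosed fun f g hf hfg => ?_
  have hunif := BoundedContinuousFunction.tendsto_iff_tendstoUniformly.1 hfg
  refine ⟨hunif.uniformContinuous (Frequently.of_forall fun n => (hf n).1),
    differentiableOn_of_tendstoUniformlyOn isOpen_ball (fun n => (hf n).2) ?_⟩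
  rw [Metric.tendstoUniformlyOn_iff]
  intro ε hε
  filter_upwards [Metric.tendstoUniformly_iff.1 hunif ε hε] with n hn x hx
  rw [extend_closedBall_apply _ hx, extend_closedBall_apply _ hx]
  exact hn _

instance [CompleteSpace X] : CompleteSpace (Au X) :=
  isClosed_Au.completeSpace_coe

theorem exists_Au_apply_eq {G : X → X} (hd : DifferentiableOn ℂ G (ball 0 1))
    (huc : UniformContinuousOn G (closedBall 0 1)) {C : ℝ}
    (hb : ∀ x ∈ closedBall (0 : X) 1, ‖G x‖ ≤ C) : ∃ g : Au X, ∀ x, g.1 x = G x := by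
  have huc' : UniformContinuous fun x : closedBall (0 : X) 1 => G x :=
    uniformContinuousOn_iff_restrict.1 huc
  refine ⟨⟨BoundedContinuousFunction.ofNormedAddCommGroup (fun x => G x) huc'.continuous C
    fun x => hb x x.2, huc', ?_⟩, fun x => rfl⟩
  exact hd.congr fun x hx => extend_closedBall_apply _ hx

end

/-! ### Sequence spaces -/

section SequenceSpace

variable {X : Type*} [NormedAddCommGroup X] [NormedSpace ℂ X] {coord : X →ₗ[ℂ] (ℕ → ℂ)}

theorem IsSequenceSpace.ext (hseq : IsSequenceSpace coord) {x y : X}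
    (h : ∀ n, coord x n = coord y n) : x = y :=
  hseq.injective (funext h)

theorem IsSequenceSpace.norm_le (hseq : IsSequenceSpace coord) {x y : X}
    (h : ∀ n, ‖coord x n‖ ≤ ‖coord y n‖) : ‖x‖ ≤ ‖y‖ := by
  obtain ⟨z, hz, hzy⟩ := hseq.solid y (coord x) h
  rwa [hseq.injective hz] at hzy

theorem IsSequenceSpace.exists_multiplier (hseq : IsSequenceSpace coord) {m : ℕ → ℂ}
    (hm : ∀ n, ‖m n‖ ≤ 1) :
    ∃ T : X →L[ℂ] X, ∀ x n, coord (T x) n = m n * coord x n := by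
  have h : ∀ x : X, ∃ y : X, coord y = (fun n => m n * coord x n) ∧ ‖y‖ ≤ ‖x‖ := fun x =>
    hseq.solid x _ fun n => by
      rw [norm_mul]
      exact mul_le_of_le_one_left (norm_nonneg _) (hm n)
  choose T hT hTle using h
  refine ⟨LinearMap.mkContinuous
    { toFun := T
      map_add' := fun x y => hseq.ext fun n => ?_
      map_smul' := fun c x => hseq.ext fun n => ?_ } 1 fun x => ?_, fun x n => ?_⟩
  · simp [hT, mul_add]
  · simp [hT, mul_left_comm]
  · simpa using hTle x
  · simp [hT]

theorem norm_indicator_one_le (A : Set ℕ) (n : ℕ) : ‖A.indicator (1 : ℕ → ℂ) n‖ ≤ 1 := by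
  by_cases h : n ∈ A <;> simp [h]

/-- The band projection onto the sequences supported in `A`. -/
noncomputable def bandProj (hseq : IsSequenceSpace coord) (A : Set ℕ) : X →L[ℂ] X :=
  (hseq.exists_multiplier (norm_indicator_one_le A)).choose

theorem coord_bandProj (hseq : IsSequenceSpace coord) (A : Set ℕ) (x : X) (n : ℕ) :
    coord (bandProj hseq A x) n = A.indicator (coord x) n := by
  rw [bandProj, (hseq.exists_multiplier (norm_indicator_one_le A)).choose_spec x n]
  by_cases h : n ∈ A <;> simp [h]

theorem norm_bandProj_le (hseq : IsSequenceSpace coord) (A : Set ℕ) (x : X) :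
    ‖bandProj hseq A x‖ ≤ ‖x‖ :=
  hseq.norm_le fun n => by
    rw [coord_bandProj]
    exact norm_indicator_le_norm_self _ _

theorem coord_sum_smul_bandProj (hseq : IsSequenceSpace coord) (A : Finset ℕ) (c : ℕ → ℂ) (x : X)
    (n : ℕ) : coord (∑ i ∈ A, c i • bandProj hseq {i} x) n =
      if n ∈ A then c n * coord x n else 0 := by
  rw [map_sum, Finset.sum_apply, ← Finset.sum_ite_eq A n fun i => c i * coord x i]
  refine Finset.sum_congr rfl fun i _ => ?_
  rw [map_smul, Pi.smul_apply, coord_bandProj, Set.indicator_apply, smul_eq_mul]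
  by_cases h : n = i
  · simp [h]
  · simp [h]

theorem sum_bandProj (hseq : IsSequenceSpace coord) (A : Finset ℕ) (x : X) :
    ∑ i ∈ A, bandProj hseq {i} x = bandProj hseq A x :=
  hseq.ext fun n => by
    have h := coord_sum_smul_bandProj hseq A (fun _ => 1) x n
    simp only [one_smul, one_mul] at h
    rw [h, coord_bandProj, Set.indicator_apply]
    simp

/-- Lattice norms only see moduli, so the coordinates can be rotated independently under a
functional. -/
theorem sum_norm_apply_bandProj_le (hseq : IsSequenceSpace coord) (A : Finset ℕ)
    {φ : StrongDual ℂ X} (hφ : ‖φ‖ ≤ 1) (x : X) :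
    ∑ i ∈ A, ‖φ (bandProj hseq {i} x)‖ ≤ ‖x‖ := by
  have h : ∀ i, ∃ c : ℂ, ‖c‖ = 1 ∧ c * φ (bandProj hseq {i} x) = ‖φ (bandProj hseq {i} x)‖ := by
    intro i
    set w := φ (bandProj hseq {i} x)
    by_cases hw : w = 0
    · exact ⟨1, by simp, by simp [hw]⟩
    · have hw' : (‖w‖ : ℂ) ≠ 0 := by simpa using hw
      exact ⟨‖w‖ / w, by simp [hw], by field_simp⟩
  choose c hc hcw using h
  have hsum : φ (∑ i ∈ A, c i • bandProj hseq {i} x) =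
      ((∑ i ∈ A, ‖φ (bandProj hseq {i} x)‖ : ℝ) : ℂ) := by
    rw [map_sum, Complex.ofReal_sum]
    exact Finset.sum_congr rfl fun i _ => by rw [map_smul, smul_eq_mul, hcw]
  have hle := φ.le_of_opNorm_le hφ (∑ i ∈ A, c i • bandProj hseq {i} x)
  rw [hsum, Complex.norm_real, Real.norm_of_nonneg (by positivity), one_mul] at hle
  refine hle.trans (hseq.norm_le fun n => ?_)
  rw [coord_sum_smul_bandProj]
  split_ifs <;> simp [hc]

theorem tendsto_bandProj_Iio (hseq : IsSequenceSpace coord) (hoc : IsOrderContinuous coord)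
    (x : X) : Tendsto (fun k => bandProj hseq (Set.Iio k) x) atTop (𝓝 x) := by
  have h : ∀ k : ℕ, ∃ u : X,
      coord u = fun n => (((if n < k then 0 else ‖coord x n‖ : ℝ)) : ℂ) := fun k => by
    obtain ⟨u, hu, -⟩ := hseq.solid x
      (fun n => (((if n < k then 0 else ‖coord x n‖ : ℝ)) : ℂ)) fun n => by split_ifs <;> simp
    exact ⟨u, hu⟩
  choose u hu using h
  have hlim := hoc u (fun k n => if n < k then 0 else ‖coord x n‖)
    (fun k n => by rw [hu]) (fun n j k hjk => ?_) fun n => ?_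
  · rw [tendsto_iff_norm_sub_tendsto_zero]
    refine squeeze_zero (fun k => norm_nonneg _) (fun k => hseq.norm_le fun n => ?_) hlim
    rw [map_sub, Pi.sub_apply, coord_bandProj, hu, Set.indicator_apply]
    by_cases h : n < k <;> simp [h]
  · by_cases h : n < k
    · simp only [h, if_true]
      split_ifs <;> simp
    · simp [h, show ¬n < j by omega]
  · refine tendsto_const_nhds.congr' ?_
    filter_upwards [eventually_gt_atTop n] with k hk
    simp [hk]

theorem mem_closure_finite_support (hseq : IsSequenceSpace coord) (hoc : IsOrderContinuous coord)
    {x : X} (hx : ‖x‖ = 1) :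
    x ∈ closure {t : X | ‖t‖ = 1 ∧ (Function.support (coord t)).Finite} := by
  have hlim := tendsto_bandProj_Iio hseq hoc x
  have hnorm := hlim.norm
  rw [hx] at hnorm
  have hlim' : Tendsto (fun k => (((‖bandProj hseq (Set.Iio k) x‖⁻¹ : ℝ)) : ℂ) •
      bandProj hseq (Set.Iio k) x) atTop (𝓝 x) := by
    have h := ((Complex.continuous_ofReal.tendsto _).comp (hnorm.inv₀ one_ne_zero)).smul hlim
    simpa using h
  refine mem_closure_of_tendsto hlim' ?_
  filter_upwards [hnorm.eventually_ne one_ne_zero] with k hk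
  refine ⟨by rw [norm_smul, Complex.norm_real, norm_inv, norm_norm, inv_mul_cancel₀ hk],
    (Set.finite_Iio k).subset fun n hn => ?_⟩
  by_contra hcon
  apply hn
  rw [map_smul, Pi.smul_apply, coord_bandProj, Set.indicator_of_notMem hcon, smul_zero]

end SequenceSpace

/-! ### Peak functions at finitely supported unit vectors -/

section Peak

variable {X : Type*} [NormedAddCommGroup X] [NormedSpace ℂ X] {coord : X →ₗ[ℂ] (ℕ → ℂ)}

/-- The identity `Re (ζ - a)² = |ζ - a|² - 2 (Im ζ)²` leaves a term `(Im ζ)²` with the wrong sign,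
which the linear part compensates because `(Im ζ)² ≤ 2 (|ζ| - Re ζ)` for `|ζ| ≤ 1`. -/
theorem re_peak_exponent_le {ι : Type*} (A : Finset ι) (w : ι → ℂ) (a : ι → ℝ)
    (hw : ∑ i ∈ A, ‖w i‖ ≤ 1) :
    (4 * (∑ i ∈ A, w i - 1) - ∑ i ∈ A, (w i - a i) ^ 2).re ≤ -∑ i ∈ A, ‖w i - a i‖ ^ 2 := by
  have h1 : ∀ i ∈ A, ‖w i‖ ≤ 1 := fun i hi =>
    (Finset.single_le_sum (f := fun i => ‖w i‖) (fun _ _ => norm_nonneg _) hi).trans hw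
  have h2 : ∑ i ∈ A, (‖w i - a i‖ ^ 2 - ((w i - a i) ^ 2).re) ≤
      ∑ i ∈ A, (4 * ‖w i‖ - 4 * (w i).re) := by
    refine Finset.sum_le_sum fun i hi => ?_
    have hsq : ‖w i - a i‖ ^ 2 - ((w i - a i) ^ 2).re = 2 * (w i).im ^ 2 := by
      rw [← Complex.normSq_eq_norm_sq, Complex.normSq_apply, sq (w i - a i), Complex.mul_re]
      simp
      ring
    have him : (w i).im ^ 2 = (‖w i‖ - (w i).re) * (‖w i‖ + (w i).re) := by
      have h := Complex.normSq_eq_norm_sq (w i)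
      rw [Complex.normSq_apply] at h
      linarith
    rw [hsq, him]
    nlinarith [h1 i hi, Complex.re_le_norm (w i)]
  rw [Finset.sum_sub_distrib, Finset.sum_sub_distrib, ← Finset.mul_sum, ← Finset.mul_sum] at h2
  simp only [Complex.sub_re, Complex.mul_re, Complex.re_sum, Complex.one_re]
  norm_num
  linarith

/-- `x₀` is a strong peak point of the entire functions that are uniformly continuous on the closed
unit ball. -/
def IsEntirePeakPoint (x₀ : X) : Prop :=
  ∃ G : X → ℂ, Differentiable ℂ G ∧ UniformContinuousOn G (closedBall 0 1) ∧ G x₀ = 1 ∧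
    (∀ z ∈ closedBall (0 : X) 1, ‖G z‖ ≤ 1) ∧
    ∀ r : ℝ, 0 < r → ∃ θ < 1, ∀ z ∈ closedBall (0 : X) 1, r ≤ ‖z - x₀‖ → ‖G z‖ ≤ θ

/-- If the part in `A` of a vector `z` of the unit ball is close to `x₀`, then local uniform
`c`-convexity at `x₀`, applied to the part outside `A`, forces `z` itself to be close to `x₀`. -/
theorem exists_norm_sub_lt_of_bandProj (hseq : IsSequenceSpace coord)
    (hconv : IsLocallyUniformlyCConvex X) {x₀ : X} (hx₀ : ‖x₀‖ = 1) (A : Set ℕ) {r : ℝ}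
    (hr : 0 < r) : ∃ δ : ℝ, 0 < δ ∧ ∀ z ∈ closedBall (0 : X) 1,
      ‖bandProj hseq A z - x₀‖ < δ → ‖z - x₀‖ < r := by
  obtain ⟨δ, hδ, h⟩ := hconv x₀ hx₀ (r / 2) (by positivity)
  refine ⟨min δ (r / 2), by positivity, fun z hz hzδ => ?_⟩
  rw [mem_closedBall_zero_iff] at hz
  obtain ⟨h1, h2⟩ := lt_min_iff.1 hzδ
  have hy : ‖z - bandProj hseq A z‖ < r / 2 := by
    by_contra! hcon
    obtain ⟨ζ, hζ, hle⟩ := h _ hcon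
    have hrot : ‖bandProj hseq A z + ζ • (z - bandProj hseq A z)‖ ≤ ‖z‖ :=
      hseq.norm_le fun n => by
        rw [map_add, map_smul, map_sub, Pi.add_apply, Pi.smul_apply, Pi.sub_apply, coord_bandProj]
        by_cases hn : n ∈ A <;> simp [hn, hζ]
    have htri := norm_sub_le (bandProj hseq A z + ζ • (z - bandProj hseq A z))
      (bandProj hseq A z - x₀)
    rw [show bandProj hseq A z + ζ • (z - bandProj hseq A z) - (bandProj hseq A z - x₀) =
      x₀ + ζ • (z - bandProj hseq A z) by abel] at htri
    linarith
  have htri := norm_add_le (z - bandProj hseq A z) (bandProj hseq A z - x₀)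
  rw [sub_add_sub_cancel] at htri
  linarith

/-- Strict monotonicity of the norm, in dual form: a functional that supports the unit ball at `x₀`
does not vanish on any nonzero coordinate of `x₀`. -/
theorem apply_bandProj_singleton_ne_zero (hseq : IsSequenceSpace coord)
    (hconv : IsLocallyUniformlyCConvex X) {x₀ : X} (hx₀ : ‖x₀‖ = 1) {φ : StrongDual ℂ X}
    (hφ : ‖φ‖ ≤ 1) (hφx : φ x₀ = 1) {i : ℕ} (hi : coord x₀ i ≠ 0) :
    φ (bandProj hseq {i} x₀) ≠ 0 := by
  intro h0
  set y := bandProj hseq {i} x₀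
  have hcoord : ∀ n, coord y n = if n = i then coord x₀ n else 0 := fun n => by
    rw [coord_bandProj, Set.indicator_apply]
    simp
  have hy : y ≠ 0 := by
    intro hy
    have h := hcoord i
    rw [hy, map_zero, if_pos rfl] at h
    exact hi h.symm
  have hnorm : ‖x₀ - y‖ = 1 := by
    refine le_antisymm ((hseq.norm_le fun n => ?_).trans hx₀.le) ?_
    · rw [map_sub, Pi.sub_apply, hcoord]
      split_ifs <;> simp
    · have h := φ.le_of_opNorm_le hφ (x₀ - y)
      rw [map_sub, h0, hφx] at h
      simpa using h
  obtain ⟨δ, hδ, h⟩ := hconv (x₀ - y) hnorm ‖y‖ (norm_pos_iff.2 hy)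
  obtain ⟨ζ, hζ, hle⟩ := h y le_rfl
  have hrot : ‖x₀ - y + ζ • y‖ ≤ ‖x₀‖ := hseq.norm_le fun n => by
    rw [map_add, map_smul, map_sub, Pi.add_apply, Pi.smul_apply, Pi.sub_apply, hcoord]
    split_ifs <;> simp [hζ]
  linarith

/-- With `φ` supporting the unit ball at `x₀` and `w i z = φ (z i • e i)`, the function
`exp (4 (∑ w i z - 1) - ∑ (w i z - w i x₀)²)`, summed over the support of `x₀`, peaks at `x₀`. -/
theorem isEntirePeakPoint_of_finite_support (hseq : IsSequenceSpace coord)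
    (hconv : IsLocallyUniformlyCConvex X) {x₀ : X} (hx₀ : ‖x₀‖ = 1)
    (hfin : (Function.support (coord x₀)).Finite) : IsEntirePeakPoint x₀ := by
  obtain ⟨φ, hφ, hφx⟩ := exists_dual_vector'' ℂ x₀
  rw [hx₀, RCLike.ofReal_one] at hφx
  set A : Finset ℕ := hfin.toFinset with hA
  have hAmem : ∀ i, i ∈ A ↔ coord x₀ i ≠ 0 := fun i => by simp [hA]
  set w : ℕ → StrongDual ℂ X := fun i => φ.comp (bandProj hseq {i}) with hw
  have hwsum : ∀ (B : Finset ℕ) (z : X), z ∈ closedBall (0 : X) 1 → ∑ i ∈ B, ‖w i z‖ ≤ 1 :=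
    fun B z hz => (sum_norm_apply_bandProj_le hseq B hφ z).trans (mem_closedBall_zero_iff.1 hz)
  have hx₀mem : x₀ ∈ closedBall (0 : X) 1 := mem_closedBall_zero_iff.2 hx₀.le
  have hproj : bandProj hseq (A : Set ℕ) x₀ = x₀ := hseq.ext fun n => by
    rw [coord_bandProj, Set.indicator_apply]
    split_ifs with h
    · rfl
    · by_contra hcon
      exact h ((hAmem n).2 (Ne.symm hcon))
  have hwx₀sum : ∑ i ∈ A, w i x₀ = 1 := by
    simp only [hw, ContinuousLinearMap.comp_apply]
    rw [← map_sum, sum_bandProj, hproj, hφx]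
  set a : ℕ → ℝ := fun i => ‖w i x₀‖ with ha
  -- The numbers `w i x₀` have sum `1` and moduli of sum at most `1`, so they are nonnegative.
  have hwx₀ : ∀ i ∈ A, w i x₀ = a i := by
    have hre : ∀ i ∈ A, (w i x₀).re = ‖w i x₀‖ := by
      refine (Finset.sum_eq_sum_iff_of_le fun i _ => Complex.re_le_norm _).1 (le_antisymm
        (Finset.sum_le_sum fun i _ => Complex.re_le_norm _) ?_)
      rw [← Complex.re_sum, hwx₀sum, Complex.one_re]
      exact hwsum A x₀ hx₀mem
    intro i hi
    have him : (w i x₀).im = 0 := Complex.abs_re_eq_norm.1 (by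
      rw [hre i hi, abs_of_nonneg (norm_nonneg _)])
    exact Complex.ext (by simp [ha, hre i hi]) (by simp [him])
  have hapos : ∀ i ∈ A, 0 < a i := fun i hi =>
    norm_pos_iff.2 (apply_bandProj_singleton_ne_zero hseq hconv hx₀ hφ hφx ((hAmem i).1 hi))
  set Φ : (ℕ → ℂ) → ℂ := fun u =>
    Complex.exp (4 * (∑ i ∈ A, u i - 1) - ∑ i ∈ A, (u i - a i) ^ 2) with hΦ
  have hΦcont : Continuous Φ := by fun_prop
  have hbound : ∀ z ∈ closedBall (0 : X) 1,
      ‖Φ fun i => w i z‖ ≤ Real.exp (-∑ i ∈ A, ‖w i z - a i‖ ^ 2) := fun z hz => by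
    rw [Complex.norm_exp]
    exact Real.exp_le_exp.2 (re_peak_exponent_le A _ a (hwsum A z hz))
  refine ⟨fun z => Φ fun i => w i z, by simp only [hΦ]; fun_prop, ?_, ?_, fun z hz => ?_,
    fun r hr => ?_⟩
  · have hcompact : IsCompact (Set.univ.pi fun _ : ℕ => closedBall (0 : ℂ) 1) :=
      isCompact_univ_pi fun _ => isCompact_closedBall _ _
    refine (hcompact.uniformContinuousOn_of_continuous hΦcont.continuousOn).comp
      (g := Φ) (f := fun z i => w i z) ?_ fun z hz i _ => ?_
    · exact (uniformContinuous_pi.2 fun i => (w i).uniformContinuous).uniformContinuousOn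
    · simpa using hwsum {i} z hz
  · have h0 : ∑ i ∈ A, (w i x₀ - a i) ^ 2 = 0 :=
      Finset.sum_eq_zero fun i hi => by rw [hwx₀ i hi, sub_self, zero_pow two_ne_zero]
    simp only [hΦ, h0, hwx₀sum, sub_self, mul_zero, Complex.exp_zero]
  · exact (hbound z hz).trans (Real.exp_le_one_iff.2 (neg_nonpos.2 (by positivity)))
  · obtain ⟨δ, hδ, hclose⟩ := exists_norm_sub_lt_of_bandProj hseq hconv hx₀ (A : Set ℕ) hr
    set K : ℝ := ∑ i ∈ A, (‖x₀‖ / a i) ^ 2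
    have hKnn : 0 ≤ K := by positivity
    refine ⟨Real.exp (-(δ ^ 2 / (K + 1))), Real.exp_lt_one_iff.2 (neg_neg_of_pos (by positivity)),
      fun z hz hzr => (hbound z hz).trans (Real.exp_le_exp.2 (neg_le_neg ?_))⟩
    have hfar : δ ≤ ‖bandProj hseq (A : Set ℕ) z - x₀‖ := by
      by_contra! hcon
      exact absurd (hclose z hz hcon) (not_lt.2 hzr)
    have hcomp : ∀ i ∈ A, bandProj hseq {i} z - bandProj hseq {i} x₀ =
        ((w i z - a i) / a i) • bandProj hseq {i} x₀ := by
      intro i hi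
      have hxi : coord x₀ i ≠ 0 := (hAmem i).1 hi
      have hsm : bandProj hseq {i} z = (coord z i / coord x₀ i) • bandProj hseq {i} x₀ :=
        hseq.ext fun n => by
          rw [map_smul, Pi.smul_apply, coord_bandProj, coord_bandProj]
          by_cases hn : n = i
          · simp [hn, hxi]
          · simp [hn]
      have ha0 : (a i : ℂ) ≠ 0 := by exact_mod_cast (hapos i hi).ne'
      have hwz : w i z = (coord z i / coord x₀ i) * a i := by
        rw [← hwx₀ i hi]
        simp only [hw, ContinuousLinearMap.comp_apply]
        rw [hsm, map_smul, smul_eq_mul]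
      rw [hwz, hsm, sub_div, mul_div_cancel_right₀ _ ha0, div_self ha0, sub_smul, one_smul]
    have hle : ‖bandProj hseq (A : Set ℕ) z - x₀‖ ≤ ∑ i ∈ A, ‖w i z - a i‖ * (‖x₀‖ / a i) := by
      rw [← sum_bandProj hseq A z]
      nth_rw 1 [← hproj]
      rw [← sum_bandProj hseq A x₀, ← Finset.sum_sub_distrib]
      refine norm_sum_le_of_le _ fun i hi => ?_
      rw [hcomp i hi, norm_smul, norm_div, Complex.norm_real, Real.norm_of_nonneg (hapos i hi).le,
        div_mul_eq_mul_div, mul_div_assoc]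
      gcongr
      · exact norm_bandProj_le hseq _ _
    have hcs := Finset.sum_mul_sq_le_sq_mul_sq A (fun i => ‖w i z - a i‖) fun i => ‖x₀‖ / a i
    have hsq : δ ^ 2 ≤ (∑ i ∈ A, ‖w i z - a i‖ * (‖x₀‖ / a i)) ^ 2 :=
      pow_le_pow_left₀ hδ.le (hfar.trans hle) 2
    rw [div_le_iff₀ (by positivity)]
    have hnn : 0 ≤ ∑ i ∈ A, ‖w i z - a i‖ ^ 2 := by positivity
    nlinarith

/-- Powers of a peak function, multiplied by a constant vector: bumps in `A_u` with prescribed value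
`v` at `x₀` that are uniformly small away from `x₀`. -/
theorem IsEntirePeakPoint.exists_Au {x₀ : X} (hpeak : IsEntirePeakPoint x₀) {v : X}
    (hv : ‖v‖ = 1) {r η : ℝ} (hr : 0 < r) (hη : 0 < η) :
    ∃ k : Au X, ‖k‖ ≤ 1 ∧ (∀ z : closedBall (0 : X) 1, (z : X) = x₀ → k.1 z = v) ∧
      ∀ z : closedBall (0 : X) 1, r ≤ ‖(z : X) - x₀‖ → ‖k.1 z‖ ≤ η := by
  obtain ⟨G, hd, huc, hG1, hGle, hGfar⟩ := hpeak
  obtain ⟨θ, hθ, hfar⟩ := hGfar r hr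
  obtain ⟨m, hm⟩ := exists_pow_lt_of_lt_one hη (max_lt hθ zero_lt_one)
  have hnorm : ∀ z, ‖G z ^ m • v‖ = ‖G z‖ ^ m := fun z => by rw [norm_smul, norm_pow, hv, mul_one]
  have hle : ∀ z ∈ closedBall (0 : X) 1, ‖G z ^ m • v‖ ≤ 1 := fun z hz => by
    rw [hnorm]
    exact pow_le_one₀ (norm_nonneg _) (hGle z hz)
  have hucm : UniformContinuousOn (fun z => G z ^ m • v) (closedBall 0 1) := by
    have hcompact : IsCompact (closedBall (0 : ℂ) 1) := isCompact_closedBall _ _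
    refine (hcompact.uniformContinuousOn_of_continuous (f := fun ζ : ℂ => ζ ^ m • v)
      (by fun_prop)).comp (f := G) huc fun z hz => ?_
    exact mem_closedBall_zero_iff.2 (hGle z hz)
  obtain ⟨k, hk⟩ := exists_Au_apply_eq (by fun_prop) hucm hle
  refine ⟨k, (BoundedContinuousFunction.norm_le zero_le_one).2 fun z => ?_, fun z hz => ?_,
    fun z hz => ?_⟩
  · change ‖k.1 z‖ ≤ 1
    rw [hk]
    exact hle z z.2
  · rw [hk, hz, hG1, one_pow, one_smul]
  · rw [hk, hnorm]
    exact (pow_le_pow_left₀ (norm_nonneg _) ((hfar z z.2 hz).trans (le_max_left _ _)) m).trans hm.le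

end Peak

/-! ### Duality pairs -/

section Duality

variable {X : Type*} [NormedAddCommGroup X] [NormedSpace ℂ X]

theorem norm_apply_le_of_mem_dualityPairs (p : dualityPairs X) (x : X) : ‖p.1.2 x‖ ≤ ‖x‖ := by
  simpa using (WeakDual.toStrongDual p.1.2).le_of_opNorm_le p.2.1 x

theorem norm_fst_of_mem_dualityPairs (p : dualityPairs X) : ‖(p.1.1 : X)‖ = 1 := by
  refine le_antisymm (mem_closedBall_zero_iff.1 p.1.1.2) ?_
  simpa [p.2.2] using norm_apply_le_of_mem_dualityPairs p p.1.1

theorem exists_dualityPair {x : X} (hx : ‖x‖ = 1) : ∃ p : dualityPairs X, (p.1.1 : X) = x := by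
  obtain ⟨φ, hφ, hφx⟩ := exists_dual_vector'' ℂ x
  rw [hx, RCLike.ofReal_one] at hφx
  exact ⟨⟨(⟨x, mem_closedBall_zero_iff.2 hx.le⟩, StrongDual.toWeakDual φ), hφ, hφx⟩, rfl⟩

/-- In a smooth space, convergence of the points of duality pairs entails weak-`*` convergence of the
functionals: by the Banach–Alaoglu theorem it suffices that each cluster point is a supporting
functional at the limit. -/
theorem tendsto_dualityPairs (hsmooth : IsSmooth X) {ι : Type*} {l : Filter ι}
    {p : ι → dualityPairs X} {q : dualityPairs X}
    (h : Tendsto (fun i => (p i).1.1) l (𝓝 q.1.1)) : Tendsto p l (𝓝 q) := by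
  rw [tendsto_subtype_rng]
  refine Tendsto.prodMk_nhds h ?_
  refine (WeakDual.isCompact_closedBall (0 : StrongDual ℂ X) 1).tendsto_nhds_of_unique_mapClusterPt
    (Eventually.of_forall fun i => ?_) fun ψ hψ hcluster => ?_
  · exact mem_closedBall_zero_iff.2 (p i).2.1
  · have hlim : Tendsto (fun i => (p i).1.2 (q.1.1 : X)) l (𝓝 1) := by
      rw [tendsto_iff_norm_sub_tendsto_zero]
      have h0 := tendsto_iff_norm_sub_tendsto_zero.1 ((continuous_subtype_val.tendsto _).comp h)
      refine squeeze_zero (fun _ => norm_nonneg _) (fun i => ?_) h0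
      have h1 := norm_apply_le_of_mem_dualityPairs (p i) (q.1.1 - (p i).1.1 : X)
      rw [map_sub, (p i).2.2] at h1
      rwa [Function.comp_apply, norm_sub_rev ((p i).1.1 : X)]
    have hψq : MapClusterPt (ψ (q.1.1 : X)) l fun i => (p i).1.2 (q.1.1 : X) :=
      hcluster.tendsto_comp ((WeakDual.eval_continuous (q.1.1 : X)).tendsto ψ)
    have hψ1 : ψ (q.1.1 : X) = 1 := by
      have : NeBot (𝓝 (ψ (q.1.1 : X)) ⊓ 𝓝 1) := hψq.neBot.mono (inf_le_inf_left _ hlim)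
      exact eq_of_nhds_neBot this
    obtain ⟨φ, -, huniq⟩ := hsmooth q.1.1 (norm_fst_of_mem_dualityPairs q)
    have e1 := huniq (WeakDual.toStrongDual ψ)
      ⟨mem_closedBall_zero_iff.1 hψ, (congrArg Complex.re hψ1).trans Complex.one_re⟩
    have e2 := huniq (WeakDual.toStrongDual q.1.2)
      ⟨q.2.1, (congrArg Complex.re q.2.2).trans Complex.one_re⟩
    exact WeakDual.toStrongDual.injective (e1.trans e2.symm)

theorem tendsto_apply_dualityPairs (f : closedBall (0 : X) 1 →ᵇ X) {ι : Type*} {l : Filter ι}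
    {p : ι → dualityPairs X} {q : dualityPairs X} (h : Tendsto p l (𝓝 q)) :
    Tendsto (fun i => (p i).1.2 (f (p i).1.1)) l (𝓝 (q.1.2 (f q.1.1))) := by
  rw [tendsto_subtype_rng] at h
  have hfst := (continuous_fst.tendsto _).comp h
  have hsnd := ((WeakDual.eval_continuous (f q.1.1)).tendsto _).comp
    ((continuous_snd.tendsto _).comp h)
  refine hsnd.congr_dist (squeeze_zero (fun _ => dist_nonneg) (fun i => ?_)
    (tendsto_iff_dist_tendsto_zero.1 ((f.continuous.tendsto _).comp hfst)))
  have h1 := norm_apply_le_of_mem_dualityPairs (p i) (f (p i).1.1 - f q.1.1)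
  rw [map_sub] at h1
  simpa [dist_eq_norm, norm_sub_rev] using h1

end Duality

/-! ### Norm and numerical strong peak functions -/

section

variable {X : Type*} [NormedAddCommGroup X] [NormedSpace ℂ X]

/-- A unit vector that lengthens `a`; for `a = 0` any unit vector does. -/
theorem exists_norm_eq_one_norm_add_smul {E : Type*} [NormedAddCommGroup E] [NormedSpace ℂ E]
    {u : E} (hu : ‖u‖ = 1) (a : E) :
    ∃ v : E, ‖v‖ = 1 ∧ ∀ ε : ℝ, 0 ≤ ε → ‖a + (ε : ℂ) • v‖ = ‖a‖ + ε := by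
  by_cases ha : a = 0
  · refine ⟨u, hu, fun ε hε => ?_⟩
    rw [ha, zero_add, norm_smul, hu, Complex.norm_real, Real.norm_of_nonneg hε, norm_zero]
    ring
  · have ha' : ‖a‖ ≠ 0 := norm_ne_zero_iff.2 ha
    refine ⟨((‖a‖⁻¹ : ℝ) : ℂ) • a, by
      rw [norm_smul, Complex.norm_real, norm_inv, norm_norm, inv_mul_cancel₀ ha'], fun ε hε => ?_⟩
    have h : a + (ε : ℂ) • ((‖a‖⁻¹ : ℝ) : ℂ) • a = ((1 + ε * ‖a‖⁻¹ : ℝ) : ℂ) • a := by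
      push_cast
      module
    rw [h, norm_smul, Complex.norm_real, Real.norm_of_nonneg (by positivity)]
    field_simp

/-- The maximum modulus principle on complex lines through the origin. -/
theorem exists_norm_eq_one_norm_apply_le [Nontrivial X] (f : Au X) (x : closedBall (0 : X) 1) :
    ∃ y : closedBall (0 : X) 1, ‖(y : X)‖ = 1 ∧ ‖f.1 x‖ ≤ ‖f.1 y‖ := by
  obtain ⟨u, hu, c, hc, hxu⟩ : ∃ u : X, ‖u‖ = 1 ∧ ∃ c : ℂ, ‖c‖ ≤ 1 ∧ c • u = x := by
    have hx := mem_closedBall_zero_iff.1 x.2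
    by_cases h0 : (x : X) = 0
    · obtain ⟨u, hu⟩ := exists_norm_eq X zero_le_one
      exact ⟨u, hu, 0, by simp, by simp [h0]⟩
    · have h0' : ‖(x : X)‖ ≠ 0 := norm_ne_zero_iff.2 h0
      refine ⟨((‖(x : X)‖⁻¹ : ℝ) : ℂ) • (x : X), ?_, ‖(x : X)‖, by simpa using hx, ?_⟩
      · rw [norm_smul, Complex.norm_real, norm_inv, norm_norm, inv_mul_cancel₀ h0']
      · rw [smul_smul, ← Complex.ofReal_mul, mul_inv_cancel₀ h0', Complex.ofReal_one, one_smul]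
  have hnorm : ∀ ζ : ℂ, ‖ζ • u‖ = ‖ζ‖ := fun ζ => by rw [norm_smul, hu, mul_one]
  have hmem : ∀ ζ ∈ closedBall (0 : ℂ) 1, ζ • u ∈ closedBall (0 : X) 1 := fun ζ hζ => by
    rw [mem_closedBall_zero_iff] at hζ ⊢
    rwa [hnorm]
  have hext : ∀ z : closedBall (0 : X) 1, Function.extend Subtype.val f.1 0 (z : X) = f.1 z :=
    fun z => Subtype.val_injective.extend_apply _ _ z
  have hdiff : DiffContOnCl ℂ (fun ζ : ℂ => Function.extend Subtype.val f.1 0 (ζ • u))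
      (ball 0 1) := by
    refine ⟨f.2.2.comp (f := fun ζ : ℂ => ζ • u) (by fun_prop) fun ζ hζ => ?_, ?_⟩
    · rw [mem_ball_zero_iff] at hζ ⊢
      rwa [hnorm]
    · rw [closure_ball _ one_ne_zero, continuousOn_iff_continuous_domRestrict]
      have hcont : Continuous fun ζ : closedBall (0 : ℂ) 1 =>
          f.1 ⟨(ζ : ℂ) • u, hmem ζ ζ.2⟩ := f.1.continuous.comp (by fun_prop)
      exact hcont.congr fun ζ => (hext ⟨(ζ : ℂ) • u, hmem ζ ζ.2⟩).symm
  obtain ⟨ζ, hζ, hmax⟩ := Complex.exists_mem_frontier_isMaxOn_norm isBounded_ball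
    (nonempty_ball.2 zero_lt_one) hdiff
  rw [frontier_ball _ one_ne_zero, mem_sphere_zero_iff_norm] at hζ
  rw [closure_ball _ one_ne_zero] at hmax
  have hle := hmax (mem_closedBall_zero_iff.2 hc)
  refine ⟨⟨ζ • u, hmem ζ (mem_closedBall_zero_iff.2 hζ.le)⟩, by rw [hnorm, hζ], ?_⟩
  simp only [Function.comp_apply, Set.mem_ofPred_eq, hxu] at hle
  rw [hext x] at hle
  exact hle.trans_eq (congrArg norm (hext ⟨ζ • u, hmem ζ (mem_closedBall_zero_iff.2 hζ.le)⟩))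

/-- The seminorm `f ↦ ‖f x‖` on `A_u(B_X : X)`. -/
noncomputable def evalSeminorm (x : closedBall (0 : X) 1) : Seminorm ℂ (Au X) :=
  (normSeminorm ℂ X).comp
    ({ toFun := fun f => f.1 x
       map_add' := fun _ _ => rfl
       map_smul' := fun _ _ => rfl } : Au X →ₗ[ℂ] X)

theorem evalSeminorm_apply (x : closedBall (0 : X) 1) (f : Au X) :
    evalSeminorm x f = ‖f.1 x‖ := rfl

theorem evalSeminorm_le (x : closedBall (0 : X) 1) (f : Au X) : evalSeminorm x f ≤ ‖f‖ :=
  f.1.norm_coe_le_norm x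

theorem iSup_evalSeminorm (f : Au X) : ⨆ x, evalSeminorm x f = ‖f.1‖ :=
  (BoundedContinuousFunction.norm_eq_iSup_norm f.1).symm

/-- The seminorm `f ↦ |x* (f x)|` on `A_u(B_X : X)`. -/
noncomputable def pairSeminorm (p : dualityPairs X) : Seminorm ℂ (Au X) :=
  (normSeminorm ℂ ℂ).comp
    ({ toFun := fun f => p.1.2 (f.1 p.1.1)
       map_add' := fun f g => map_add p.1.2 (f.1 p.1.1) (g.1 p.1.1)
       map_smul' := fun c f => map_smul p.1.2 c (f.1 p.1.1) } : Au X →ₗ[ℂ] ℂ)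

theorem pairSeminorm_apply (p : dualityPairs X) (f : Au X) :
    pairSeminorm p f = ‖p.1.2 (f.1 p.1.1)‖ := rfl

theorem pairSeminorm_le (p : dualityPairs X) (f : Au X) : pairSeminorm p f ≤ ‖f‖ :=
  (norm_apply_le_of_mem_dualityPairs p _).trans (f.1.norm_coe_le_norm _)

instance [Nontrivial X] : Nonempty (dualityPairs X) := by
  obtain ⟨x, hx⟩ := exists_norm_eq X zero_le_one
  exact ⟨(exists_dualityPair hx).choose⟩

theorem isStrongPeak_iff [CompleteSpace X] [Nontrivial X] (f : Au X) :
    IsStrongPeak f.1 ↔ ∀ n : ℕ, f ∈ concentrated evalSeminorm id (1 / ((n : ℝ) + 1)) := by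
  have : CompleteSpace (closedBall (0 : X) 1) := isClosed_closedBall.completeSpace_coe
  rw [forall_mem_concentrated_iff (q := evalSeminorm (X := X)) evalSeminorm_le, iSup_evalSeminorm]
  refine ⟨fun h => h.2, fun h => ⟨fun h0 => ?_, h⟩⟩
  -- For `f = 0` every sequence is maximizing, but the ball has more than one point.
  obtain ⟨t, ht⟩ := h
  obtain ⟨u, hu⟩ := exists_norm_eq X zero_le_one
  have hconst : ∀ s : closedBall (0 : X) 1, s = t := fun s => by
    refine tendsto_nhds_unique (f := fun _ : ℕ => s) tendsto_const_nhds (ht _ ?_)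
    simp [evalSeminorm_apply, h0]
  have h1 := (hconst 0).trans (hconst ⟨u, mem_closedBall_zero_iff.2 hu.le⟩).symm
  have h2 : (0 : X) = u := congrArg Subtype.val h1
  rw [← h2, norm_zero] at hu
  exact zero_ne_one hu

theorem isNumericalStrongPeak_iff [CompleteSpace X] [Nontrivial X] (hsmooth : IsSmooth X)
    (f : Au X) : IsNumericalStrongPeak f.1 ↔
      ∀ n : ℕ, f ∈ concentrated pairSeminorm (fun p => p.1.1) (1 / ((n : ℝ) + 1)) := by
  have : CompleteSpace (closedBall (0 : X) 1) := isClosed_closedBall.completeSpace_coe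
  rw [forall_mem_concentrated_iff (q := pairSeminorm (X := X)) pairSeminorm_le]
  constructor
  · rintro ⟨q, hq⟩
    exact ⟨q.1.1, fun p hp =>
      ((continuous_fst.comp continuous_subtype_val).tendsto q).comp (hq p hp)⟩
  · rintro ⟨x, hx⟩
    obtain ⟨p₀, hp₀⟩ := exists_tendsto_iSup (fun p => pairSeminorm p f)
      (bddAbove_range_seminorm (q := pairSeminorm (X := X)) pairSeminorm_le f)
    have hnorm : ‖(x : X)‖ = 1 := by
      refine tendsto_nhds_unique
        (((continuous_norm.comp continuous_subtype_val).tendsto x).comp (hx p₀ hp₀)) ?_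
      refine tendsto_const_nhds.congr fun n => ?_
      exact (norm_fst_of_mem_dualityPairs (p₀ n)).symm
    obtain ⟨q, hq⟩ := exists_dualityPair hnorm
    refine ⟨q, fun p hp => tendsto_dualityPairs hsmooth ?_⟩
    rw [Subtype.ext hq]
    exact hx p hp

variable {coord : X →ₗ[ℂ] (ℕ → ℂ)}

theorem dense_concentrated_evalSeminorm [Nontrivial X]
    (hseq : IsSequenceSpace coord) (hoc : IsOrderContinuous coord)
    (hconv : IsLocallyUniformlyCConvex X) {ε : ℝ} (hε : 0 < ε) :
    Dense (concentrated (evalSeminorm (X := X)) id ε) := by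
  refine dense_concentrated (q := evalSeminorm (X := X)) evalSeminorm_le (fun f δ hδ => ?_) hε
  obtain ⟨x, hx⟩ := exists_lt_of_lt_ciSup (sub_lt_self (⨆ x, evalSeminorm x f) hδ)
  obtain ⟨y, hy, hxy⟩ := exists_norm_eq_one_norm_apply_le f x
  have hlt : (⨆ x, evalSeminorm x f) - δ < ‖f.1 y‖ := hx.trans_le hxy
  obtain ⟨t, ht, htlim⟩ := mem_closure_iff_seq_limit.1 (mem_closure_finite_support hseq hoc hy)
  have htlim' : Tendsto (fun n => (⟨t n, mem_closedBall_zero_iff.2 (ht n).1.le⟩ :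
      closedBall (0 : X) 1)) atTop (𝓝 y) := tendsto_subtype_rng.2 htlim
  obtain ⟨n, hn⟩ := (((f.1.continuous.norm.tendsto y).comp htlim').eventually_const_lt hlt).exists
  refine ⟨_, hn, fun r hr η hη => ?_⟩
  set s : closedBall (0 : X) 1 := ⟨t n, mem_closedBall_zero_iff.2 (ht n).1.le⟩
  obtain ⟨v, hv, hadd⟩ := exists_norm_eq_one_norm_add_smul (ht n).1 (f.1 s)
  obtain ⟨k, hk, hks, hkfar⟩ := (isEntirePeakPoint_of_finite_support hseq hconv (ht n).1
    (ht n).2).exists_Au hv hr hη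
  refine ⟨k, hk, fun ε hε => ?_, fun z hz => hkfar z ?_⟩
  · have h := hadd ε hε
    rw [← hks s rfl] at h
    exact h.ge
  · rwa [id, id, Subtype.dist_eq, dist_eq_norm] at hz

theorem dense_concentrated_pairSeminorm [Nontrivial X]
    (hseq : IsSequenceSpace coord) (hoc : IsOrderContinuous coord)
    (hconv : IsLocallyUniformlyCConvex X) (hsmooth : IsSmooth X) {ε : ℝ} (hε : 0 < ε) :
    Dense (concentrated (pairSeminorm (X := X)) (fun p => p.1.1) ε) := by
  refine dense_concentrated (q := pairSeminorm (X := X)) pairSeminorm_le (fun f δ hδ => ?_) hε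
  obtain ⟨q, hq⟩ := exists_lt_of_lt_ciSup (sub_lt_self (⨆ p, pairSeminorm p f) hδ)
  obtain ⟨t, ht, htlim⟩ := mem_closure_iff_seq_limit.1
    (mem_closure_finite_support hseq hoc (norm_fst_of_mem_dualityPairs q))
  choose p hp using fun n => exists_dualityPair (ht n).1
  have hlim : Tendsto p atTop (𝓝 q) := by
    refine tendsto_dualityPairs hsmooth (tendsto_subtype_rng.2 ?_)
    simpa only [hp] using htlim
  obtain ⟨n, hn⟩ := ((tendsto_apply_dualityPairs f.1 hlim).norm.eventually_const_lt hq).exists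
  refine ⟨p n, hn, fun r hr η hη => ?_⟩
  -- A unimodular multiple of the point `t n` itself is a direction in which `f` can be raised.
  obtain ⟨c, hc, hadd⟩ := exists_norm_eq_one_norm_add_smul (norm_one (α := ℂ))
    ((p n).1.2 (f.1 (p n).1.1))
  obtain ⟨k, hk, hks, hkfar⟩ := (isEntirePeakPoint_of_finite_support hseq hconv (ht n).1
    (ht n).2).exists_Au (v := c • t n) (by rw [norm_smul, hc, (ht n).1, one_mul]) hr hη
  refine ⟨k, hk, fun ε hε => ?_, fun z hz => ?_⟩
  · have hval : (p n).1.2 (k.1 (p n).1.1) = c := by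
      have h1 : (p n).1.2 (t n) = 1 := by
        rw [← hp n]
        exact (p n).2.2
      rw [hks _ (hp n), map_smul, h1, smul_eq_mul, mul_one]
    have h := hadd ε hε
    rw [← hval, ← map_smul, ← map_add] at h
    exact h.ge
  · refine (norm_apply_le_of_mem_dualityPairs z _).trans (hkfar _ ?_)
    rwa [Subtype.dist_eq, dist_eq_norm, hp n] at hz

end

end PeakFunctions

theorem corollary3p4 {X : Type*} [NormedAddCommGroup X] [NormedSpace ℂ X] [CompleteSpace X]
    [Nontrivial X] (coord : X →ₗ[ℂ] (ℕ → ℂ))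
    (hseq : PeakFunctions.IsSequenceSpace coord)
    (hoc : PeakFunctions.IsOrderContinuous coord)
    (hconv : PeakFunctions.IsLocallyUniformlyCConvex X)
    (hsmooth : PeakFunctions.IsSmooth X) :
    Dense {f : PeakFunctions.Au X | PeakFunctions.IsStrongPeak f.1 ∧
        PeakFunctions.IsNumericalStrongPeak f.1} ∧
      IsGδ {f : PeakFunctions.Au X | PeakFunctions.IsStrongPeak f.1 ∧
        PeakFunctions.IsNumericalStrongPeak f.1} := by
  have hset : {f : PeakFunctions.Au X | PeakFunctions.IsStrongPeak f.1 ∧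
      PeakFunctions.IsNumericalStrongPeak f.1} =
      (⋂ n : ℕ, PeakFunctions.concentrated PeakFunctions.evalSeminorm id (1 / ((n : ℝ) + 1))) ∩
      ⋂ n : ℕ, PeakFunctions.concentrated PeakFunctions.pairSeminorm (fun p => p.1.1)
        (1 / ((n : ℝ) + 1)) := by
    ext f
    rw [Set.mem_ofPred_eq, PeakFunctions.isStrongPeak_iff,
      PeakFunctions.isNumericalStrongPeak_iff hsmooth, Set.mem_inter_iff, Set.mem_iInter,
      Set.mem_iInter]
  have hopen₁ := fun n : ℕ => PeakFunctions.isOpen_concentrated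
    (q := PeakFunctions.evalSeminorm (X := X)) (pos := id)
    PeakFunctions.evalSeminorm_le (1 / ((n : ℝ) + 1))
  have hopen₂ := fun n : ℕ => PeakFunctions.isOpen_concentrated
    (q := PeakFunctions.pairSeminorm (X := X)) (pos := fun p => p.1.1)
    PeakFunctions.pairSeminorm_le (1 / ((n : ℝ) + 1))
  have hdense₁ := dense_iInter_of_isOpen_nat hopen₁ fun n =>
    PeakFunctions.dense_concentrated_evalSeminorm hseq hoc hconv Nat.one_div_pos_of_nat
  have hdense₂ := dense_iInter_of_isOpen_nat hopen₂ fun n =>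
    PeakFunctions.dense_concentrated_pairSeminorm hseq hoc hconv hsmooth Nat.one_div_pos_of_nat
  have hG₁ := IsGδ.iInter_of_isOpen hopen₁
  have hG₂ := IsGδ.iInter_of_isOpen hopen₂
  rw [hset]
  exact ⟨hdense₁.inter_of_Gδ hG₁ hG₂ hdense₂, hG₁.inter hG₂⟩
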